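/- Let $\mathbb{H}^2$ be the hyperbolic plane (the complete, simply connected surface of constant curvature $-1$), with its hyperbolic area measure $\operatorname{vol}_2^h$. Call a set $S\subset\mathbb{H}^2$ geodesically convex if it contains the geodesic segment between any two of its points, and let $\operatorname{conv}(S)$ denote the smallest geodesically convex set containing $S$. A convex body is a compact, geodesically convex set $K\subset\mathbb{H}^2$ with nonempty interior. For a convex body $K$, a point $x\in\mathbb{H}^2$ and $\delta>0$ put $[x,K]:=\operatorname{conv}(\{x\}\cup K)$ and $$\mathcal{I}^h_\delta(K):=\{x\in\mathbb{H}^2 : \operatorname{vol}_2^h([x,K]\setminus K)\le\delta\}.$$ **Theorem.** For every convex body $K\subset\mathbb{H}^2$ and every $\delta>0$, the illumination body $\mathcal{I}^h_\delta(K)$ is geodesically convex. -/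

import Mathlib

/-!
The hyperbolic plane of curvature `-1` is Mathlib's `UpperHalfPlane`, with its hyperbolic distance
and its Riemannian area measure `dx dy / y ^ 2` (the `volume` of `UpperHalfPlane`).
-/

namespace HyperbolicPlane

/-- `γ`, restricted to `[0, 1]`, is a constant speed geodesic segment. In the hyperbolic plane every
geodesic segment is minimizing, so these are exactly the curves along which the distance is
proportional to the difference of the parameters (speed `0`, the constant curve, is allowed). -/
def IsGeodesicSegment (γ : ℝ → UpperHalfPlane) : Prop :=
  ∃ v : ℝ, ∀ s ∈ Set.Icc (0 : ℝ) 1, ∀ t ∈ Set.Icc (0 : ℝ) 1, dist (γ s) (γ t) = v * |s - t|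

/-- A set is geodesically convex if it contains the geodesic segment between any two of its
points. -/
def IsGeodesicallyConvex (S : Set UpperHalfPlane) : Prop :=
  ∀ γ : ℝ → UpperHalfPlane, IsGeodesicSegment γ → γ 0 ∈ S → γ 1 ∈ S →
    ∀ t ∈ Set.Icc (0 : ℝ) 1, γ t ∈ S

/-- The geodesic convex hull: the smallest geodesically convex set that contains `S`. -/
def geodesicHull (S : Set UpperHalfPlane) : Set UpperHalfPlane :=
  ⋂₀ {C : Set UpperHalfPlane | IsGeodesicallyConvex C ∧ S ⊆ C}

/-- A convex body: a compact, geodesically convex set with nonempty interior. -/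
structure IsConvexBody (K : Set UpperHalfPlane) : Prop where
  isCompact : IsCompact K
  isGeodesicallyConvex : IsGeodesicallyConvex K
  nonempty_interior : (interior K).Nonempty

/-- The illumination body of `K` with parameter `δ`: all points `x` such that the hyperbolic area of
`[x, K] \ K` is at most `δ`, where `[x, K]` is the geodesic convex hull of `{x} ∪ K`. -/
def illuminationBody (δ : ℝ) (K : Set UpperHalfPlane) : Set UpperHalfPlane :=
  {x | MeasureTheory.volume (geodesicHull ({x} ∪ K) \ K) ≤ ENNReal.ofReal δ}

end HyperbolicPlane

/-! The map `z ↦ (re z, |z|²)` straightens geodesics, because vertical lines and circles centred on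
the real axis are exactly where `re` and `|z|²` satisfy an affine relation. Its image is convex, so
geodesic convexity becomes Euclidean convexity (`isGeodesicallyConvex_iff_convex_image`).

Let `z` lie between `x` and `y`, outside `K`. Seen from `z`, `K` fills a cone through two of its
points `p`, `q` (`exists_supporting_cone`). Move `p`, `q` to the imaginary axis with `re z > 0`.
Then `[z, K]` is covered by the triangle `z p q` and the part of `K` with `re ≤ 0`, whereas for any
`w` with `re w > 0` the hull `[w, K]` contains the triangle `w p q` and that same part of `K`. So it
suffices that the area of a triangle on a fixed base is quasiconvex in its apex. By
`volume_halfTriangle` this area increases with `re w / D w`. In the chart `re` is affine and the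
positive function `D` is concave, hence the quotient is quasiconvex where it is positive
(`exists_volume_halfTriangle_le`). -/

namespace HyperbolicPlane

open UpperHalfPlane MeasureTheory
open scoped MatrixGroups Pointwise

/-! ### The straightening chart -/

/-- A chart of the hyperbolic plane in which geodesic segments become Euclidean segments. -/
def chart (z : ℍ) : ℝ × ℝ := (z.re, z.re ^ 2 + z.im ^ 2)

lemma chart_injective : Function.Injective chart := by
  intro z w h
  simp only [chart, Prod.mk.injEq] at h
  refine UpperHalfPlane.ext_re_im h.1 ?_
  have h2 : z.im ^ 2 = w.im ^ 2 := by
    have := h.2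
    rw [h.1] at this
    linarith
  exact (pow_left_inj₀ z.im_pos.le w.im_pos.le two_ne_zero).1 h2

lemma continuous_chart : Continuous chart := by
  unfold chart
  exact continuous_re.prodMk ((continuous_re.pow 2).add (continuous_im.pow 2))

lemma range_chart : Set.range chart = {p : ℝ × ℝ | p.1 ^ 2 < p.2} := by
  ext p
  constructor
  · rintro ⟨z, rfl⟩
    have := z.im_pos
    simp only [chart, Set.mem_ofPred_eq]
    nlinarith
  · intro hp
    have hp' : 0 < p.2 - p.1 ^ 2 := sub_pos.2 hp
    refine ⟨⟨⟨p.1, √(p.2 - p.1 ^ 2)⟩, Real.sqrt_pos.2 hp'⟩, ?_⟩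
    ext
    · rfl
    · change p.1 ^ 2 + √(p.2 - p.1 ^ 2) ^ 2 = p.2
      rw [Real.sq_sqrt hp'.le]
      ring

lemma convex_range_chart : Convex ℝ (Set.range chart) := by
  rw [range_chart]
  rintro ⟨a, b⟩ h ⟨c, d⟩ h' s t hs ht hst
  simp only [Set.mem_ofPred_eq, Prod.smul_mk, smul_eq_mul, Prod.mk_add_mk] at *
  obtain rfl : s = 1 - t := by linarith
  rcases ht.eq_or_lt with rfl | ht
  · simpa using h
  · nlinarith [mul_nonneg (mul_nonneg hs ht.le) (sq_nonneg (a - c)),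
      mul_nonneg hs (sub_nonneg.2 h.le), mul_pos ht (sub_pos.2 h')]

/-! ### Betweenness and its invariance under `SL(2, ℝ)` -/

/-- `z` lies on the geodesic segment between `x` and `y`. -/
def Between (x z y : ℍ) : Prop := chart z ∈ segment ℝ (chart x) (chart y)

lemma between_iff {x z y : ℍ} : Between x z y ↔ ∃ t ∈ Set.Icc (0 : ℝ) 1,
    z.re = (1 - t) * x.re + t * y.re ∧
    z.re ^ 2 + z.im ^ 2 = (1 - t) * (x.re ^ 2 + x.im ^ 2) + t * (y.re ^ 2 + y.im ^ 2) := by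
  simp only [Between, segment_eq_image, Set.mem_image, chart, Prod.smul_mk, Prod.mk_add_mk,
    smul_eq_mul, Prod.mk.injEq, eq_comm]

/-- The homogeneous form of `Between`, which is visibly projectively invariant. -/
lemma between_iff_homogeneous {x z y : ℍ} : Between x z y ↔ ∃ s t : ℝ, 0 ≤ s ∧ 0 ≤ t ∧
    1 = s + t ∧ z.re = s * x.re + t * y.re ∧
    z.re ^ 2 + z.im ^ 2 = s * (x.re ^ 2 + x.im ^ 2) + t * (y.re ^ 2 + y.im ^ 2) := by
  rw [between_iff]
  constructor
  · rintro ⟨t, ⟨h0, h1⟩, h⟩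
    exact ⟨1 - t, t, by linarith, h0, by ring, h⟩
  · rintro ⟨s, t, h0, h1, h2, h⟩
    obtain rfl : s = 1 - t := by linarith
    exact ⟨t, ⟨h1, by linarith⟩, h⟩

/-- Up to the factor `D = |cz + d|²`, the vector `(1, re z, |z|²)` transforms linearly under `g`.
Möbius maps are therefore projective in the chart and preserve segments. -/
lemma smul_eqs (g : SL(2, ℝ)) (z : ℍ) : ∃ D : ℝ, 0 < D ∧
    D = g 1 0 ^ 2 * (z.re ^ 2 + z.im ^ 2) + 2 * g 1 0 * g 1 1 * z.re + g 1 1 ^ 2 ∧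
    (g • z).re * D = g 0 0 * g 1 0 * (z.re ^ 2 + z.im ^ 2) +
      (g 0 0 * g 1 1 + g 0 1 * g 1 0) * z.re + g 0 1 * g 1 1 ∧
    ((g • z).re ^ 2 + (g • z).im ^ 2) * D = g 0 0 ^ 2 * (z.re ^ 2 + z.im ^ 2) +
      2 * g 0 0 * g 0 1 * z.re + g 0 1 ^ 2 := by
  have hdet : g 0 0 * g 1 1 - g 0 1 * g 1 0 = 1 := by
    rw [← Matrix.det_fin_two, g.2]
  have key := UpperHalfPlane.coe_specialLinearGroup_apply g z
  simp only [Algebra.algebraMap_self, RingHom.id_apply] at key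
  have hD : 0 < Complex.normSq (g 1 0 * z + g 1 1 : ℂ) := by
    rw [Complex.normSq_pos]
    intro h
    have h1 := congrArg Complex.im h
    have h2 := congrArg Complex.re h
    simp [z.im_ne_zero] at h1 h2
    rw [h1] at h2
    simp at h2
    rw [h1, h2] at hdet
    simp at hdet
  have hne : (g 1 0 * z + g 1 1 : ℂ) ≠ 0 := Complex.normSq_pos.1 hD
  have hmul : ((g • z : ℍ) : ℂ) * (g 1 0 * z + g 1 1 : ℂ) = g 0 0 * z + g 0 1 := by
    rw [key, div_mul_cancel₀ _ hne]
  have hre := congrArg Complex.re hmul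
  have him := congrArg Complex.im hmul
  have hn := congrArg Complex.normSq hmul
  rw [Complex.normSq_mul] at hn
  simp [Complex.normSq_apply] at hre him hn hD
  refine ⟨_, hD, by ring, ?_, ?_⟩
  · linear_combination (g 1 0 * z.re + g 1 1) * hre + g 1 0 * z.im * him
  · linear_combination hn

lemma Between.smul {x z y : ℍ} (h : Between x z y) (g : SL(2, ℝ)) :
    Between (g • x) (g • z) (g • y) := by
  rw [between_iff_homogeneous] at h ⊢
  obtain ⟨s, t, hs, ht, h1, h2, h3⟩ := h
  obtain ⟨Dx, hDx, ex, ex1, ex2⟩ := smul_eqs g x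
  obtain ⟨Dy, hDy, ey, ey1, ey2⟩ := smul_eqs g y
  obtain ⟨Dz, hDz, ez, ez1, ez2⟩ := smul_eqs g z
  refine ⟨s * Dx / Dz, t * Dy / Dz, by positivity, by positivity, ?_, ?_, ?_⟩
  · field_simp
    rw [ez, ex, ey, h3, h2]
    linear_combination g 1 1 ^ 2 * h1
  · field_simp
    rw [ez1, h3, h2]
    linear_combination (g 0 1 * g 1 1) * h1 - s * ex1 - t * ey1
  · field_simp
    rw [ez2, h3, h2]
    linear_combination (g 0 1 ^ 2) * h1 - s * ex2 - t * ey2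

lemma between_smul_iff {x z y : ℍ} (g : SL(2, ℝ)) :
    Between (g • x) (g • z) (g • y) ↔ Between x z y :=
  ⟨fun h => by simpa using h.smul g⁻¹, fun h => h.smul g⟩

lemma exists_smul_re_eq_zero (x y : ℍ) : ∃ g : SL(2, ℝ), (g • x).re = 0 ∧ (g • y).re = 0 := by
  suffices H : ∃ g : SL(2, ℝ), ∀ w ∈ ({x, y} : Set ℍ), g 0 0 * g 1 0 * (w.re ^ 2 + w.im ^ 2) +
      (g 0 0 * g 1 1 + g 0 1 * g 1 0) * w.re + g 0 1 * g 1 1 = 0 by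
    obtain ⟨g, hg⟩ := H
    have aux : ∀ w ∈ ({x, y} : Set ℍ), (g • w).re = 0 := by
      intro w hw
      obtain ⟨D, hD, -, h, -⟩ := smul_eqs g w
      rw [hg w hw] at h
      exact (mul_eq_zero.1 h).resolve_right hD.ne'
    exact ⟨g, aux x (by simp), aux y (by simp)⟩
  by_cases hxy : x.re = y.re
  · refine ⟨⟨!![1, -x.re; 0, 1], by simp [Matrix.det_fin_two]⟩, ?_⟩
    rintro w (rfl | rfl)
    · simp
    · simp [hxy]
  · have hne : x.re - y.re ≠ 0 := sub_ne_zero.2 hxy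
    set c : ℝ := ((x.re ^ 2 + x.im ^ 2) - (y.re ^ 2 + y.im ^ 2)) / (2 * (x.re - y.re)) with hc
    set r : ℝ := √((x.re - c) ^ 2 + x.im ^ 2) with hr
    have hxim := x.im_pos
    have hr0 : 0 < r := Real.sqrt_pos.2 (by positivity)
    have hr2 : r ^ 2 = (x.re - c) ^ 2 + x.im ^ 2 := Real.sq_sqrt (by positivity)
    have hce : 2 * c * (x.re - y.re) = (x.re ^ 2 + x.im ^ 2) - (y.re ^ 2 + y.im ^ 2) := by
      rw [hc]; field_simp
    -- The geodesic through `x` and `y` is the semicircle with centre `c` and radius `r`; this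
    -- matrix sends its endpoints `c - r` and `c + r` to `0` and `∞`.
    refine ⟨⟨!![1, -(c - r); -(1 / (2 * r)), (c + r) / (2 * r)], ?_⟩, ?_⟩
    · rw [Matrix.det_fin_two_of]
      field_simp
      ring
    · rintro w (rfl | rfl)
      · simp
        field_simp
        linear_combination hr2
      · simp
        field_simp
        linear_combination hr2 - hce

/-! ### Metric geodesics are chart segments -/

lemma re_eq_of_dist_log_im {z w : ℍ} (h : dist z w ≤ dist (Real.log z.im) (Real.log w.im)) :
    z.re = w.re := by
  set w' : ℍ := ⟨⟨z.re, w.im⟩, w.im_pos⟩ with hw'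
  have h1 : dist z w' = dist (Real.log z.im) (Real.log w.im) :=
    UpperHalfPlane.dist_of_re_eq rfl
  have h2 : Real.cosh (dist z w) ≤ Real.cosh (dist z w') := by
    rw [Real.cosh_le_cosh, abs_of_nonneg dist_nonneg, abs_of_nonneg dist_nonneg, h1]
    exact h
  rw [cosh_dist', cosh_dist'] at h2
  have hz := z.im_pos
  have hw := w.im_pos
  have e1 : w'.re = z.re := rfl
  have e2 : w'.im = w.im := rfl
  rw [e1, e2, div_le_div_iff_of_pos_right (by positivity)] at h2
  have : (z.re - w.re) ^ 2 = 0 := le_antisymm (by linarith) (sq_nonneg _)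
  exact sub_eq_zero.1 (pow_eq_zero_iff two_ne_zero |>.1 this)

lemma between_iff_of_re_eq_zero {x z y : ℍ} (hx : x.re = 0) (hy : y.re = 0) :
    Between x z y ↔ z.re = 0 ∧ Real.log z.im ∈ segment ℝ (Real.log x.im) (Real.log y.im) := by
  have mono : ∀ {a b c : ℍ}, a.im ≤ b.im → b.im ≤ c.im →
      Real.log a.im ≤ Real.log b.im ∧ Real.log b.im ≤ Real.log c.im := fun {a b c} h1 h2 =>
    ⟨Real.log_le_log a.im_pos h1, Real.log_le_log b.im_pos h2⟩
  have key : Between x z y ↔ z.re = 0 ∧ z.im ^ 2 ∈ segment ℝ (x.im ^ 2) (y.im ^ 2) := by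
    rw [between_iff]
    simp only [segment_eq_image, Set.mem_image, smul_eq_mul]
    constructor
    · rintro ⟨t, ht, h1, h2⟩
      have hz : z.re = 0 := by rw [h1, hx, hy]; ring
      refine ⟨hz, t, ht, ?_⟩
      rw [hx, hy, hz] at h2
      linear_combination -h2
    · rintro ⟨hz, t, ht, h⟩
      refine ⟨t, ht, ?_, ?_⟩
      · rw [hx, hy, hz]; ring
      · rw [hx, hy, hz]; linear_combination -h
  rw [key]
  refine and_congr_right fun _ => ?_
  have hx := x.im_pos
  have hy := y.im_pos
  have hz := z.im_pos
  rw [segment_eq_uIcc, segment_eq_uIcc, Set.mem_uIcc, Set.mem_uIcc]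
  simp only [pow_le_pow_iff_left₀ hx.le hz.le two_ne_zero,
    pow_le_pow_iff_left₀ hz.le hy.le two_ne_zero, pow_le_pow_iff_left₀ hy.le hz.le two_ne_zero,
    pow_le_pow_iff_left₀ hz.le hx.le two_ne_zero, Real.log_le_log_iff hx hz,
    Real.log_le_log_iff hz hx, Real.log_le_log_iff hy hz, Real.log_le_log_iff hz hy]

/-- With `x` and `y` moved to the imaginary axis, their distance is that of `log im`. Since `log im`
is 1-Lipschitz, equality in the triangle inequality forces equality at each step, which puts `z` on
the axis, between them. -/
lemma between_of_dist_add_dist {x z y : ℍ} (h : dist x z + dist z y = dist x y) :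
    Between x z y := by
  obtain ⟨g, hx, hy⟩ := exists_smul_re_eq_zero x y
  rw [← between_smul_iff g, between_iff_of_re_eq_zero hx hy]
  rw [← dist_smul g x z, ← dist_smul g z y, ← dist_smul g x y] at h
  generalize g • x = x at *
  generalize g • y = y at *
  generalize g • z = z at *
  rw [UpperHalfPlane.dist_of_re_eq (hx.trans hy.symm)] at h
  have h1 := UpperHalfPlane.dist_log_im_le x z
  have h2 := UpperHalfPlane.dist_log_im_le z y
  have h3 := dist_triangle (Real.log x.im) (Real.log z.im) (Real.log y.im)
  refine ⟨?_, ?_⟩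
  · rw [← hx]
    exact (re_eq_of_dist_log_im (by linarith)).symm
  · rw [mem_segment_iff_wbtw, ← dist_add_dist_eq_iff]
    linarith

lemma IsGeodesicallyConvex.mem_of_between {S : Set ℍ} (hS : IsGeodesicallyConvex S) {x z y : ℍ}
    (hx : x ∈ S) (hy : y ∈ S) (h : Between x z y) : z ∈ S := by
  obtain ⟨g, hgx, hgy⟩ := exists_smul_re_eq_zero x y
  rw [← between_smul_iff g, between_iff_of_re_eq_zero hgx hgy, segment_eq_image] at h
  obtain ⟨hgz, t, ht, hzt⟩ := h
  set f : ℝ → ℍ := fun s => ⟨⟨0, Real.exp s⟩, Real.exp_pos s⟩ with hf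
  have f_log : ∀ w : ℍ, w.re = 0 → f (Real.log w.im) = w := fun w hw =>
    UpperHalfPlane.ext_re_im hw.symm (Real.exp_log w.im_pos)
  set a := Real.log (g • x).im with ha
  set b := Real.log (g • y).im with hb
  -- `s ↦ i exp s` is an isometric embedding, so an affine reparametrization has constant speed;
  -- pulling back by `g` joins `x` to `y`.
  have hγ : IsGeodesicSegment fun s => g⁻¹ • f ((1 - s) * a + s * b) := by
    refine ⟨|b - a|, fun s _ t _ => ?_⟩
    rw [dist_smul, (UpperHalfPlane.isometry_vertical_line 0).dist_eq, Real.dist_eq, ← abs_mul]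
    congr 1
    ring
  have := hS _ hγ ?_ ?_ t ht
  · simp only [smul_eq_mul] at hzt
    simpa [hzt, f_log _ hgz] using this
  · simpa [ha, f_log _ hgx] using hx
  · simpa [hb, f_log _ hgy] using hy

lemma isGeodesicallyConvex_iff_between {S : Set ℍ} : IsGeodesicallyConvex S ↔
    ∀ x ∈ S, ∀ y ∈ S, ∀ z, Between x z y → z ∈ S := by
  refine ⟨fun h x hx y hy z hz => h.mem_of_between hx hy hz, fun h γ hγ h0 h1 t ht => ?_⟩
  obtain ⟨v, hv⟩ := hγ
  refine h _ h0 _ h1 _ (between_of_dist_add_dist ?_)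
  have z0 : (0 : ℝ) ∈ Set.Icc (0 : ℝ) 1 := by simp
  have z1 : (1 : ℝ) ∈ Set.Icc (0 : ℝ) 1 := by simp
  rw [hv 0 z0 t ht, hv t ht 1 z1, hv 0 z0 1 z1, zero_sub, abs_neg, abs_of_nonneg ht.1,
    abs_sub_comm, abs_of_nonneg (sub_nonneg.2 ht.2), zero_sub, abs_neg, abs_one]
  ring

/-! ### Convexity and hulls in the chart -/

lemma isGeodesicallyConvex_iff_convex_image {S : Set ℍ} :
    IsGeodesicallyConvex S ↔ Convex ℝ (chart '' S) := by
  rw [isGeodesicallyConvex_iff_between, convex_iff_segment_subset]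
  constructor
  · rintro h _ ⟨x, hx, rfl⟩ _ ⟨y, hy, rfl⟩ p hp
    obtain ⟨z, rfl⟩ := convex_range_chart.segment_subset ⟨x, rfl⟩ ⟨y, rfl⟩ hp
    exact ⟨z, h x hx y hy z hp, rfl⟩
  · intro h x hx y hy z hz
    exact chart_injective.mem_set_image.1 (h ⟨x, hx, rfl⟩ ⟨y, hy, rfl⟩ hz)

lemma geodesicHull_eq (S : Set ℍ) : geodesicHull S = chart ⁻¹' convexHull ℝ (chart '' S) := by
  apply Set.Subset.antisymm
  · refine Set.sInter_subset_of_mem ⟨?_, ?_⟩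
    · rw [isGeodesicallyConvex_iff_convex_image, Set.image_preimage_eq_inter_range]
      exact (convex_convexHull ℝ _).inter convex_range_chart
    · exact fun x hx => subset_convexHull ℝ _ ⟨x, hx, rfl⟩
  · refine Set.subset_sInter fun C hC z hz => ?_
    rw [← chart_injective.mem_set_image]
    exact convexHull_min (Set.image_mono hC.2)
      (isGeodesicallyConvex_iff_convex_image.1 hC.1) hz

lemma mem_geodesicHull_singleton_union {K : Set ℍ} (hK : IsGeodesicallyConvex K)
    (hne : K.Nonempty) {x w : ℍ} :
    w ∈ geodesicHull ({x} ∪ K) ↔ ∃ c ∈ K, Between x w c := by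
  rw [geodesicHull_eq, Set.singleton_union, Set.image_insert_eq, Set.mem_preimage,
    convexHull_insert (hne.image _), (isGeodesicallyConvex_iff_convex_image.1 hK).convexHull_eq,
    convexJoin_singleton_left]
  simp [Between]

/-! ### The area of a triangle based on the imaginary axis -/

/-- The right half of a hyperbolic triangle with vertices `i a`, `i b` and `w`. -/
def halfTriangle (a b : ℝ) (w : ℍ) : Set ℍ :=
  {u | 0 < u.re ∧ u.re ≤ w.re ∧
    a ^ 2 + u.re * ((w.re ^ 2 + w.im ^ 2 - a ^ 2) / w.re) ≤ u.re ^ 2 + u.im ^ 2 ∧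
    u.re ^ 2 + u.im ^ 2 ≤ b ^ 2 + u.re * ((w.re ^ 2 + w.im ^ 2 - b ^ 2) / w.re)}

/-- The height over `s` of the geodesic through `i a` and `w`. -/
noncomputable def arcHeight (a : ℝ) (w : ℍ) (s : ℝ) : ℝ :=
  √(a ^ 2 + s * ((w.re ^ 2 + w.im ^ 2 - a ^ 2) / w.re) - s ^ 2)

lemma arcHeight_sq_pos {a : ℝ} (ha : 0 < a) {w : ℍ} (hw : 0 < w.re) {s : ℝ}
    (hs : s ∈ Set.Icc 0 w.re) :
    0 < a ^ 2 + s * ((w.re ^ 2 + w.im ^ 2 - a ^ 2) / w.re) - s ^ 2 := by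
  have him := w.im_pos
  have key : a ^ 2 + s * ((w.re ^ 2 + w.im ^ 2 - a ^ 2) / w.re) - s ^ 2 =
      ((w.re - s) * a ^ 2 + s * w.im ^ 2 + s * (w.re - s) * w.re) / w.re := by
    field_simp
    ring
  rw [key]
  refine div_pos ?_ hw
  have h1 := sub_nonneg.2 hs.2
  have h2 := mul_nonneg (mul_nonneg hs.1 h1) hw.le
  rcases hs.1.eq_or_lt with h | h
  · rw [← h]; simp; positivity
  · have := mul_nonneg h1 (sq_nonneg a)
    have := mul_pos h (pow_pos him 2)
    linarith

lemma arcHeight_pos {a : ℝ} (ha : 0 < a) {w : ℍ} (hw : 0 < w.re) {s : ℝ}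
    (hs : s ∈ Set.Icc 0 w.re) : 0 < arcHeight a w s :=
  Real.sqrt_pos.2 (arcHeight_sq_pos ha hw hs)

lemma arcHeight_le {a b : ℝ} (ha : 0 < a) (hab : a ≤ b) {w : ℍ} (hw : 0 < w.re) {s : ℝ}
    (hs : s ∈ Set.Icc 0 w.re) : arcHeight a w s ≤ arcHeight b w s := by
  refine Real.sqrt_le_sqrt ?_
  have key : (b ^ 2 + s * ((w.re ^ 2 + w.im ^ 2 - b ^ 2) / w.re) - s ^ 2) -
      (a ^ 2 + s * ((w.re ^ 2 + w.im ^ 2 - a ^ 2) / w.re) - s ^ 2) =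
      (w.re - s) * (b - a) * (b + a) / w.re := by
    field_simp
    ring
  rw [← sub_nonneg, key]
  exact div_nonneg (mul_nonneg (mul_nonneg (sub_nonneg.2 hs.2) (sub_nonneg.2 hab))
    (by linarith)) hw.le

lemma continuous_arcHeight (a : ℝ) (w : ℍ) : Continuous (arcHeight a w) := by
  unfold arcHeight
  fun_prop

lemma arcHeight_re {a : ℝ} {w : ℍ} (hw : 0 < w.re) : arcHeight a w w.re = w.im := by
  rw [arcHeight, mul_div_cancel₀ _ hw.ne']
  rw [show a ^ 2 + (w.re ^ 2 + w.im ^ 2 - a ^ 2) - w.re ^ 2 = w.im ^ 2 by ring]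
  exact Real.sqrt_sq w.im_pos.le

/-- `ds / height` is the central angle element of the circle carrying the arc. That circle also
passes through `-i a`, where the inscribed angle from `i a` to the moving point is `arctan (s / (a +
height))`, half the central angle. -/
lemma hasDerivAt_arctan_arcHeight {a : ℝ} (ha : 0 < a) {w : ℍ} (hw : 0 < w.re) {s : ℝ}
    (hs : s ∈ Set.Icc 0 w.re) :
    HasDerivAt (fun s => 2 * Real.arctan (s / (a + arcHeight a w s))) (arcHeight a w s)⁻¹ s := by
  have hpos := arcHeight_sq_pos ha hw hs
  have hv := arcHeight_pos ha hw hs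
  have hsq : arcHeight a w s ^ 2 = _ := Real.sq_sqrt hpos.le
  have h1 : HasDerivAt (arcHeight a w)
      (((w.re ^ 2 + w.im ^ 2 - a ^ 2) / w.re - 2 * s) / (2 * arcHeight a w s)) s := by
    refine HasDerivAt.sqrt ?_ hpos.ne'
    convert! (((hasDerivAt_id s).mul_const _).const_add (a ^ 2)).sub (hasDerivAt_pow 2 s) using 1
    simp
  convert! (((hasDerivAt_id s).div (h1.const_add a) (by positivity)).arctan).const_mul 2 using 1
  simp only [Pi.div_apply, id]
  generalize (w.re ^ 2 + w.im ^ 2 - a ^ 2) / w.re = m at *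
  generalize arcHeight a w s = v at *
  have h0 : 0 < a + v := by positivity
  field_simp
  linear_combination -hsq

lemma integral_inv_arcHeight {a : ℝ} (ha : 0 < a) {w : ℍ} (hw : 0 < w.re) :
    ∫ s in (0 : ℝ)..w.re, (arcHeight a w s)⁻¹ = 2 * Real.arctan (w.re / (a + w.im)) := by
  rw [intervalIntegral.integral_eq_sub_of_hasDerivAt (fun s hs => hasDerivAt_arctan_arcHeight ha hw
    (by rwa [Set.uIcc_of_le hw.le] at hs))]
  · simp [arcHeight_re hw]
  · refine ContinuousOn.intervalIntegrable ?_
    rw [Set.uIcc_of_le hw.le]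
    exact (continuous_arcHeight a w).continuousOn.inv₀ fun s hs => (arcHeight_pos ha hw hs).ne'

lemma lintegral_Icc_inv_sq {c d : ℝ} (hc : 0 < c) (hcd : c ≤ d) :
    ∫⁻ v in Set.Icc c d, ENNReal.ofReal ((1 / v) ^ 2) = ENNReal.ofReal (c⁻¹ - d⁻¹) := by
  have hne : ∀ v ∈ Set.Icc c d, v ≠ 0 := fun v hv => (hc.trans_le hv.1).ne'
  have hcont : ContinuousOn (fun v : ℝ => (1 / v) ^ 2) (Set.Icc c d) :=
    (continuousOn_const.div continuousOn_id hne).pow 2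
  rw [← ofReal_integral_eq_lintegral_ofReal (hcont.integrableOn_compact isCompact_Icc)
    (ae_of_all _ fun v => sq_nonneg _), integral_Icc_eq_integral_Ioc,
    ← intervalIntegral.integral_of_le hcd,
    intervalIntegral.integral_eq_sub_of_hasDerivAt (f := fun v => -v⁻¹)]
  · congr 1
    ring
  · intro v hv
    rw [Set.uIcc_of_le hcd] at hv
    convert! (hasDerivAt_inv (hne v hv)).neg using 1
    simp
  · rw [← Set.uIcc_of_le hcd] at hcont
    exact hcont.intervalIntegrable

lemma volume_eq_lintegral_prod (s : Set (ℝ × ℝ)) (hs : MeasurableSet s) :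
    volume {u : ℍ | (u.re, u.im) ∈ s} =
      ∫⁻ x, ∫⁻ y, (s ∩ {p | 0 < p.2}).indicator (fun p => ENNReal.ofReal ((1 / p.2) ^ 2)) (x, y) := by
  have hs' : MeasurableSet (s ∩ {p : ℝ × ℝ | 0 < p.2}) :=
    hs.inter (measurableSet_lt measurable_const measurable_snd)
  have himage : (UpperHalfPlane.coe '' {u : ℍ | (u.re, u.im) ∈ s}) =
      Complex.measurableEquivRealProd ⁻¹' (s ∩ {p | 0 < p.2}) := by
    ext z
    constructor
    · rintro ⟨u, hu, rfl⟩
      exact ⟨hu, u.im_pos⟩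
    · rintro ⟨h1, h2⟩
      exact ⟨⟨z, h2⟩, h1, rfl⟩
  have hm : Measurable fun p : ℝ × ℝ => ENNReal.ofReal ((1 / p.2) ^ 2) := by fun_prop
  rw [volume_eq_lintegral, himage, ← lintegral_prod _ (hm.indicator hs').aemeasurable,
    lintegral_indicator hs', ← Measure.volume_eq_prod,
    ← Complex.volume_preserving_equiv_real_prod.setLIntegral_comp_preimage hs' hm]
  refine lintegral_congr fun z => ?_
  rw [← ENNReal.ofReal_coe_nnreal]
  simp [Complex.measurableEquivRealProd]

lemma mem_halfTriangle_iff {a b : ℝ} {w : ℍ} (ha : 0 < a) (hab : a ≤ b)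
    (hw : 0 < w.re) (u : ℍ) :
    u ∈ halfTriangle a b w ↔ u.re ∈ Set.Ioc 0 w.re ∧
      u.im ∈ Set.Icc (arcHeight a w u.re) (arcHeight b w u.re) := by
  simp only [halfTriangle, Set.mem_ofPred_eq, Set.mem_Ioc, Set.mem_Icc, and_assoc, arcHeight]
  refine and_congr_right fun h0 => and_congr_right fun h1 => ?_
  have hb := arcHeight_sq_pos (ha.trans_le hab) hw ⟨h0.le, h1⟩
  rw [Real.sqrt_le_left u.im_pos.le, Real.le_sqrt' u.im_pos]
  constructor <;> rintro ⟨h, h'⟩ <;> constructor <;> linarith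

lemma volume_halfTriangle_eq_sub {a b : ℝ} {w : ℍ} (ha : 0 < a) (hab : a ≤ b) (hw : 0 < w.re) :
    volume (halfTriangle a b w) = ENNReal.ofReal
      (2 * Real.arctan (w.re / (a + w.im)) - 2 * Real.arctan (w.re / (b + w.im))) := by
  have hb := ha.trans_le hab
  set s : Set (ℝ × ℝ) := {p | p.1 ∈ Set.Ioc 0 w.re ∧
    p.2 ∈ Set.Icc (arcHeight a w p.1) (arcHeight b w p.1)} with hs
  have hca := (continuous_arcHeight a w).comp (continuous_fst (X := ℝ) (Y := ℝ))
  have hcb := (continuous_arcHeight b w).comp (continuous_fst (X := ℝ) (Y := ℝ))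
  have hms : MeasurableSet s :=
    (measurable_fst measurableSet_Ioc).inter
      ((measurableSet_le hca.measurable measurable_snd).inter
        (measurableSet_le measurable_snd hcb.measurable))
  have hT : halfTriangle a b w = {u : ℍ | (u.re, u.im) ∈ s} := by
    ext u
    exact mem_halfTriangle_iff ha hab hw u
  have hinner : ∀ x, ∫⁻ y, (s ∩ {p | 0 < p.2}).indicator
      (fun p => ENNReal.ofReal ((1 / p.2) ^ 2)) (x, y) = (Set.Ioc 0 w.re).indicator
      (fun x => ENNReal.ofReal ((arcHeight a w x)⁻¹ - (arcHeight b w x)⁻¹)) x := by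
    intro x
    by_cases hx : x ∈ Set.Ioc 0 w.re
    · have hx' := Set.Ioc_subset_Icc_self hx
      rw [Set.indicator_of_mem hx, ← lintegral_Icc_inv_sq (arcHeight_pos ha hw hx')
        (arcHeight_le ha hab hw hx'), ← lintegral_indicator measurableSet_Icc]
      refine lintegral_congr fun y => ?_
      by_cases hy : y ∈ Set.Icc (arcHeight a w x) (arcHeight b w x)
      · rw [Set.indicator_of_mem hy, Set.indicator_of_mem]
        exact ⟨⟨hx, hy⟩, (arcHeight_pos ha hw hx').trans_le hy.1⟩
      · rw [Set.indicator_of_notMem hy, Set.indicator_of_notMem]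
        exact fun h => hy h.1.2
    · rw [Set.indicator_of_notMem hx]
      simp_rw [Set.indicator_of_notMem (fun h : (x, _) ∈ s ∩ {p | 0 < p.2} => hx h.1.1)]
      simp
  have hint : ∀ {c : ℝ}, 0 < c →
      IntervalIntegrable (fun x => (arcHeight c w x)⁻¹) volume 0 w.re := by
    intro c hc
    refine ContinuousOn.intervalIntegrable ?_
    rw [Set.uIcc_of_le hw.le]
    exact (continuous_arcHeight c w).continuousOn.inv₀ fun s hs => (arcHeight_pos hc hw hs).ne'
  rw [hT, volume_eq_lintegral_prod s hms]
  simp_rw [hinner]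
  rw [lintegral_indicator measurableSet_Ioc, ← integral_inv_arcHeight ha hw,
    ← integral_inv_arcHeight hb hw, ← intervalIntegral.integral_sub (hint ha) (hint hb),
    intervalIntegral.integral_of_le hw.le, ofReal_integral_eq_lintegral_ofReal]
  · exact ((intervalIntegrable_iff_integrableOn_Ioc_of_le hw.le).1 ((hint ha).sub (hint hb)))
  · refine (ae_restrict_iff' measurableSet_Ioc).2 (ae_of_all _ fun x hx => ?_)
    have hx' := Set.Ioc_subset_Icc_self hx
    exact sub_nonneg.2 (inv_anti₀ (arcHeight_pos ha hw hx') (arcHeight_le ha hab hw hx'))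

lemma volume_halfTriangle {a b : ℝ} {w : ℍ} (ha : 0 < a) (hab : a ≤ b) (hw : 0 < w.re) :
    volume (halfTriangle a b w) = ENNReal.ofReal (2 * Real.arctan ((b - a) *
      (w.re / (a * b + (a + b) * w.im + (w.re ^ 2 + w.im ^ 2))))) := by
  have hb := ha.trans_le hab
  have him := w.im_pos
  rw [volume_halfTriangle_eq_sub ha hab hw, ← mul_sub, sub_eq_add_neg, ← Real.arctan_neg,
    Real.arctan_add]
  · have h : 1 - w.re / (a + w.im) * -(w.re / (b + w.im)) =
        (a * b + (a + b) * w.im + (w.re ^ 2 + w.im ^ 2)) / ((a + w.im) * (b + w.im)) := by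
      field_simp
      ring
    rw [h]
    congr 3
    field_simp
    ring
  · have : 0 < w.re / (a + w.im) * (w.re / (b + w.im)) := by positivity
    linarith

/-! ### Quasiconvexity in the apex -/

/-- In chart coordinates `(u, v)` the imaginary part is `√(v - u²)`, a concave function. This makes
the denominator in `volume_halfTriangle` concave. -/
lemma convexComb_im_le {x z y : ℍ} {t : ℝ} (ht : t ∈ Set.Icc (0 : ℝ) 1)
    (h1 : z.re = (1 - t) * x.re + t * y.re)
    (h2 : z.re ^ 2 + z.im ^ 2 = (1 - t) * (x.re ^ 2 + x.im ^ 2) + t * (y.re ^ 2 + y.im ^ 2)) :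
    (1 - t) * x.im + t * y.im ≤ z.im := by
  refine le_of_sq_le_sq ?_ z.im_pos.le
  have h3 : z.im ^ 2 - ((1 - t) * x.im + t * y.im) ^ 2 =
      t * (1 - t) * ((x.re - y.re) ^ 2 + (x.im - y.im) ^ 2) := by
    rw [h1] at h2
    linear_combination h2
  have := mul_nonneg (mul_nonneg ht.1 (sub_nonneg.2 ht.2))
    (add_nonneg (sq_nonneg (x.re - y.re)) (sq_nonneg (x.im - y.im)))
  linarith

/-- Quasiconvexity of the area of the triangles with two fixed vertices `i a` and `i b`. -/
lemma exists_volume_halfTriangle_le {a b : ℝ} (ha : 0 < a) (hab : a ≤ b) {x z y : ℍ}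
    (h : Between x z y) (hz : 0 < z.re) : ∃ w, (w = x ∨ w = y) ∧ 0 < w.re ∧
      volume (halfTriangle a b z) ≤ volume (halfTriangle a b w) := by
  have hb := ha.trans_le hab
  set D : ℍ → ℝ := fun w => a * b + (a + b) * w.im + (w.re ^ 2 + w.im ^ 2) with hD
  have hDpos : ∀ w, 0 < D w := fun w => by
    have := w.im_pos
    positivity
  -- Were both end ratios below `τ = z.re / D z`, concavity of `D` and `τ > 0` would give `z.re < τ
  -- * D z`, which is absurd.
  obtain ⟨w, hw, hle⟩ : ∃ w, (w = x ∨ w = y) ∧ z.re / D z ≤ w.re / D w := by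
    by_contra! hcon
    have hx := (div_lt_iff₀ (hDpos x)).1 (hcon x (.inl rfl))
    have hy := (div_lt_iff₀ (hDpos y)).1 (hcon y (.inr rfl))
    obtain ⟨t, ht, h1, h2⟩ := between_iff.1 h
    have him := convexComb_im_le ht h1 h2
    have hDz : (1 - t) * D x + t * D y ≤ D z := by
      simp only [hD]
      rw [h2]
      have := mul_le_mul_of_nonneg_left him (add_pos ha hb).le
      linarith
    have hτ : 0 < z.re / D z := div_pos hz (hDpos z)
    have e : z.re / D z * D z = z.re := div_mul_cancel₀ _ (hDpos z).ne'
    have h3 := mul_le_mul_of_nonneg_left hDz hτ.le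
    rcases ht.1.eq_or_lt with h0 | h0
    · rw [← h0] at h1 h3
      linarith
    · have h4 := mul_lt_mul_of_pos_left hy h0
      have h5 := mul_le_mul_of_nonneg_left hx.le (sub_nonneg.2 ht.2)
      linarith
  have hwre : 0 < w.re := by
    have := (div_pos hz (hDpos z)).trans_le hle
    exact (div_pos_iff_of_pos_right (hDpos w)).1 this
  refine ⟨w, hw, hwre, ?_⟩
  rw [volume_halfTriangle ha hab hz, volume_halfTriangle ha hab hwre]
  refine ENNReal.ofReal_le_ofReal (mul_le_mul_of_nonneg_left (Real.arctan_mono ?_) zero_le_two)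
  exact mul_le_mul_of_nonneg_left hle (sub_nonneg.2 hab)

/-! ### The supporting cone -/

/-- A compact convex planar set seen from an exterior point `ζ` lies in the cone spanned by two of
its points. -/
lemma exists_supporting_cone {C : Set (ℝ × ℝ)} (hC : IsCompact C) (hconv : Convex ℝ C)
    (hne : C.Nonempty) {ζ : ℝ × ℝ} (hζ : ζ ∉ C) : ∃ p ∈ C, ∃ q ∈ C, ∀ c ∈ C,
      ∃ e ∈ segment ℝ p q, c ∈ segment ℝ ζ e ∨ e ∈ segment ℝ ζ c := by
  obtain ⟨f, r, hr, hf⟩ := geometric_hahn_banach_point_closed hconv hC.isClosed hζ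
  set l := f (1, 0) with hl
  set m := f (0, 1) with hm
  have hflm : ∀ v : ℝ × ℝ, f v = l * v.1 + m * v.2 := by
    intro v
    have : v = v.1 • ((1, 0) : ℝ × ℝ) + v.2 • ((0, 1) : ℝ × ℝ) := by ext <;> simp
    conv_lhs => rw [this]
    rw [map_add, map_smul, map_smul, smul_eq_mul, smul_eq_mul]
    ring
  -- `L` and `M` are orthogonal coordinates centred at `ζ`, with `L > 0` on `C`. The slope `M / L`
  -- identifies the ray from `ζ`; its extrema on `C` give `p` and `q`, and the intermediate value
  -- theorem gives `e` on the ray of `c`.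
  set L : ℝ × ℝ → ℝ := fun c => l * (c.1 - ζ.1) + m * (c.2 - ζ.2) with hL
  set M : ℝ × ℝ → ℝ := fun c => -m * (c.1 - ζ.1) + l * (c.2 - ζ.2) with hM
  have hLpos : ∀ c ∈ C, 0 < L c := by
    intro c hc
    have := hf c hc
    rw [hflm] at this hr
    simp only [hL]
    linarith
  have hcont : ContinuousOn (fun c => M c / L c) C :=
    ContinuousOn.div (by fun_prop) (by fun_prop) fun c hc => (hLpos c hc).ne'
  obtain ⟨p, hp, hpmin⟩ := hC.exists_isMinOn hne hcont
  obtain ⟨q, hq, hqmax⟩ := hC.exists_isMaxOn hne hcont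
  refine ⟨p, hp, q, hq, fun c hc => ?_⟩
  have hsub : segment ℝ p q ⊆ C := hconv.segment_subset hp hq
  obtain ⟨e, he, hec⟩ : ∃ e ∈ segment ℝ p q, M e / L e = M c / L c :=
    (convex_segment p q).isPreconnected.intermediate_value (left_mem_segment ℝ p q)
      (right_mem_segment ℝ p q) (hcont.mono hsub) ⟨hpmin hc, hqmax hc⟩
  refine ⟨e, he, ?_⟩
  have hLe := hLpos e (hsub he)
  have hLc := hLpos c hc
  have hlm : l ^ 2 + m ^ 2 ≠ 0 := by
    intro h
    have h1 : l = 0 := by nlinarith [sq_nonneg l, sq_nonneg m]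
    have h2 : m = 0 := by nlinarith [sq_nonneg l, sq_nonneg m]
    simp [hL, h1, h2] at hLc
  have hM' : M e * L c = M c * L e := (div_eq_div_iff hLe.ne' hLc.ne').1 hec
  have h1 : (e.1 - ζ.1) * L c = (c.1 - ζ.1) * L e := by
    refine mul_left_cancel₀ hlm ?_
    simp only [hL, hM] at hM' ⊢
    linear_combination -m * hM'
  have h2 : (e.2 - ζ.2) * L c = (c.2 - ζ.2) * L e := by
    refine mul_left_cancel₀ hlm ?_
    simp only [hL, hM] at hM' ⊢
    linear_combination l * hM'
  simp only [segment_eq_image', Set.mem_image]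
  rcases le_total (L c) (L e) with h | h
  · refine .inl ⟨L c / L e, ⟨by positivity, (div_le_one hLe).2 h⟩, ?_⟩
    ext
    · simp
      field_simp
      linear_combination h1
    · simp
      field_simp
      linear_combination h2
  · refine .inr ⟨L e / L c, ⟨by positivity, (div_le_one hLc).2 h⟩, ?_⟩
    ext
    · simp
      field_simp
      linear_combination -h1
    · simp
      field_simp
      linear_combination -h2

lemma mem_segment_or_mem_segment {E : Type*} [AddCommGroup E] [Module ℝ E] {z u e c : E}
    (he : e ∈ segment ℝ z c) (hu : u ∈ segment ℝ z c) :
    u ∈ segment ℝ z e ∨ u ∈ segment ℝ e c := by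
  have hu' := mem_segment_iff_wbtw.1 hu
  rw [segment_eq_image'] at he hu
  obtain ⟨t, ht, rfl⟩ := he
  obtain ⟨s, hs, rfl⟩ := hu
  simp only [mem_segment_iff_wbtw]
  have h := wbtw_or_wbtw_smul_vadd_of_nonneg z (c - z) hs.1 ht.1
  simp only [vadd_eq_add, add_comm _ z] at h
  exact h.imp_right fun h => hu'.trans_left_right h

/-! ### Comparing hulls with triangles -/

lemma Between.symm {x z y : ℍ} (h : Between x z y) : Between y z x := by
  rwa [Between, segment_symm]

lemma Between.trans {z u c e : ℍ} (h : Between z c e) (h' : Between z u c) : Between z u e :=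
  (convex_segment _ _).segment_subset (left_mem_segment ℝ _ _) h h'

lemma Between.re_eq_zero {p e q : ℍ} (hp : p.re = 0) (hq : q.re = 0) (h : Between p e q) :
    e.re = 0 := by
  obtain ⟨t, -, h, -⟩ := between_iff.1 h
  rw [h, hp, hq]
  ring

lemma between_iff_im_sq {p e q : ℍ} (hp : p.re = 0) (hq : q.re = 0) (hpq : p.im ≤ q.im) :
    Between p e q ↔ e.re = 0 ∧ e.im ^ 2 ∈ Set.Icc (p.im ^ 2) (q.im ^ 2) := by
  rw [← segment_eq_Icc (pow_le_pow_left₀ p.im_pos.le hpq 2), between_iff, segment_eq_image]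
  constructor
  · rintro ⟨t, ht, h1, h2⟩
    have he : e.re = 0 := by rw [h1, hp, hq]; ring
    refine ⟨he, t, ht, ?_⟩
    rw [hp, hq, he] at h2
    simp only [smul_eq_mul]
    linear_combination -h2
  · rintro ⟨he, t, ht, h⟩
    simp only [smul_eq_mul] at h
    refine ⟨t, ht, ?_, ?_⟩
    · rw [hp, hq, he]; ring
    · rw [hp, hq, he]; linear_combination -h

lemma Between.mem_halfTriangle {p e q z u : ℍ} (hp : p.re = 0) (hq : q.re = 0)
    (hpq : p.im ≤ q.im) (he : Between p e q) (hz : 0 < z.re) (hu : Between z u e)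
    (hure : 0 < u.re) : u ∈ halfTriangle p.im q.im z := by
  obtain ⟨he0, he1, he2⟩ := (between_iff_im_sq hp hq hpq).1 he
  obtain ⟨t, ht, h1, h2⟩ := between_iff.1 hu
  rw [he0] at h1 h2
  have h3 : u.re / z.re = 1 - t := by
    rw [h1]; field_simp; ring
  refine ⟨hure, ?_, ?_, ?_⟩
  · have := mul_nonneg ht.1 hz.le
    linarith
  · rw [mul_div_left_comm, h3, h2]
    linarith [mul_le_mul_of_nonneg_left he1 ht.1]
  · rw [mul_div_left_comm, h3, h2]
    linarith [mul_le_mul_of_nonneg_left he2 ht.1]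

lemma exists_between_of_mem_halfTriangle {p q x u : ℍ} (hp : p.re = 0) (hq : q.re = 0)
    (hpq : p.im ≤ q.im) (hx : 0 < x.re) (hu : u ∈ halfTriangle p.im q.im x) :
    ∃ e, Between p e q ∧ Between x u e := by
  obtain ⟨h0, h1, h2, h3⟩ := hu
  set r := u.re / x.re with hr
  have hur : u.re = r * x.re := by rw [hr]; field_simp
  have hr1 : r ≤ 1 := (div_le_one hx).2 h1
  have hr0 : 0 < r := by positivity
  rw [mul_div_left_comm, ← hr] at h2 h3
  rcases hr1.eq_or_lt with h | h
  · refine ⟨p, left_mem_segment ℝ _ _, ?_⟩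
    obtain rfl : u = x := by
      apply chart_injective
      rw [h] at h2 h3 hur
      refine Prod.ext (by simpa [chart] using hur) ?_
      change u.re ^ 2 + u.im ^ 2 = x.re ^ 2 + x.im ^ 2
      linarith
    exact left_mem_segment ℝ _ _
  · have h' := sub_pos.2 h
    set E := ((u.re ^ 2 + u.im ^ 2) - r * (x.re ^ 2 + x.im ^ 2)) / (1 - r) with hE
    have hEe : (1 - r) * E = (u.re ^ 2 + u.im ^ 2) - r * (x.re ^ 2 + x.im ^ 2) := by
      rw [hE]; field_simp
    have hE1 : p.im ^ 2 ≤ E := by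
      rw [hE, le_div_iff₀ h']; linarith
    have hE2 : E ≤ q.im ^ 2 := by
      rw [hE, div_le_iff₀ h']; linarith
    have hE0 : 0 < E := (pow_pos p.im_pos 2).trans_le hE1
    have hsq : √E ^ 2 = E := Real.sq_sqrt hE0.le
    set e : ℍ := ⟨⟨0, √E⟩, Real.sqrt_pos.2 hE0⟩ with he
    have hre : e.re = 0 := rfl
    have him : e.im = √E := rfl
    refine ⟨e, (between_iff_im_sq hp hq hpq).2 ⟨rfl, ?_⟩, ?_⟩
    · rw [him, hsq]
      exact ⟨hE1, hE2⟩
    · refine between_iff.2 ⟨1 - r, ⟨h'.le, by linarith⟩, ?_, ?_⟩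
      · rw [hre, hur]; ring
      · rw [hre, him, hsq]
        linear_combination -hEe

lemma subset_geodesicHull (S : Set ℍ) : S ⊆ geodesicHull S :=
  Set.subset_sInter fun _ hC => hC.2

lemma exists_volume_geodesicHull_le {K : Set ℍ} (hKc : IsCompact K)
    (hK : IsGeodesicallyConvex K) {p q z : ℍ} (hpK : p ∈ K) (hqK : q ∈ K) (hp : p.re = 0)
    (hq : q.re = 0) (hpq : p.im ≤ q.im) (hz : 0 < z.re)
    (hcone : ∀ c ∈ K, ∃ e, Between p e q ∧ (Between z c e ∨ Between z e c)) {x y : ℍ}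
    (hxy : Between x z y) : ∃ w, (w = x ∨ w = y) ∧
      volume (geodesicHull ({z} ∪ K)) ≤ volume (geodesicHull ({w} ∪ K)) := by
  have hne : K.Nonempty := ⟨p, hpK⟩
  have hpqK : ∀ e, Between p e q → e ∈ K := fun e he => hK.mem_of_between hpK hqK he
  -- A segment from `z` to `c ∈ K` stays in the triangle until it meets `[p, q]`; beyond that it is
  -- inside `K` and in `re ≤ 0`.
  have hsub : geodesicHull ({z} ∪ K) ⊆ halfTriangle p.im q.im z ∪ K ∩ {u | u.re ≤ 0} := by
    intro u hu
    obtain ⟨c, hc, huc⟩ := (mem_geodesicHull_singleton_union hK hne).1 hu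
    obtain ⟨e, hpe, hce⟩ := hcone c hc
    have he0 := hpe.re_eq_zero hp hq
    have heK := hpqK e hpe
    have aux : Between z u e → u ∈ halfTriangle p.im q.im z ∪ K ∩ {u | u.re ≤ 0} := by
      intro hue
      rcases lt_or_ge 0 u.re with h | h
      · exact .inl (hpe.mem_halfTriangle hp hq hpq hz hue h)
      · refine .inr ⟨?_, h⟩
        obtain ⟨t, ht, h1, h2⟩ := between_iff.1 hue
        rw [he0] at h1
        have ht1 : t = 1 := by
          refine le_antisymm ht.2 ?_
          by_contra! hlt
          have := mul_pos (sub_pos.2 hlt) hz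
          linarith
        obtain rfl : u = e := by
          apply chart_injective
          rw [ht1] at h1 h2
          refine Prod.ext ?_ ?_
          · simp [chart, h1, he0]
          · simpa [chart] using h2
        exact heK
    rcases hce with hce | hce
    · exact aux (hce.trans huc)
    · rcases mem_segment_or_mem_segment hce huc with h | h
      · exact aux h
      · refine .inr ⟨hK.mem_of_between heK hc h, ?_⟩
        obtain ⟨t, ht, h1, -⟩ := between_iff.1 hce
        obtain ⟨s, hs, h2, -⟩ := between_iff.1 h
        rw [he0] at h1 h2
        have hc0 : c.re ≤ 0 := by
          by_contra! hpos
          rcases ht.1.eq_or_lt with h | h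
          · rw [← h] at h1; linarith
          · linarith [mul_pos h hpos, mul_nonneg (sub_nonneg.2 ht.2) hz.le]
        change u.re ≤ 0
        rw [h2]
        linarith [mul_nonpos_of_nonneg_of_nonpos hs.1 hc0]
  obtain ⟨w, hw, hwre, hle⟩ := exists_volume_halfTriangle_le p.im_pos hpq hxy hz
  refine ⟨w, hw, (measure_mono hsub).trans ((measure_union_le _ _).trans ?_)⟩
  have hmeas : MeasurableSet (K ∩ {u : ℍ | u.re ≤ 0}) :=
    hKc.measurableSet.inter (isClosed_le continuous_re continuous_const).measurableSet
  -- For `z` subadditivity suffices, but for `w` the two pieces must be disjoint so that their areas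
  -- add up inside `[w, K]`.
  have hdisj : Disjoint (halfTriangle p.im q.im w) (K ∩ {u : ℍ | u.re ≤ 0}) :=
    Set.disjoint_left.2 fun u hu hu' => (not_lt.2 hu'.2) hu.1
  refine (add_le_add_left hle _).trans ?_
  rw [← measure_union hdisj hmeas]
  refine measure_mono (Set.union_subset (fun u hu => ?_) fun u hu =>
    subset_geodesicHull _ (.inr hu.1))
  obtain ⟨e, he, hue⟩ := exists_between_of_mem_halfTriangle hp hq hpq hwre hu
  exact (mem_geodesicHull_singleton_union hK hne).2 ⟨e, hpqK e he, hue⟩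

/-! ### Normalizing by an isometry -/

lemma IsGeodesicallyConvex.smul {K : Set ℍ} (hK : IsGeodesicallyConvex K) (g : SL(2, ℝ)) :
    IsGeodesicallyConvex (g • K) := by
  rw [isGeodesicallyConvex_iff_between]
  rintro _ ⟨x, hx, rfl⟩ _ ⟨y, hy, rfl⟩ z hz
  refine ⟨g⁻¹ • z, hK.mem_of_between hx hy ?_, smul_inv_smul g z⟩
  simpa using hz.smul g⁻¹

lemma geodesicHull_smul {K : Set ℍ} (hK : IsGeodesicallyConvex K) (hne : K.Nonempty)
    (g : SL(2, ℝ)) (x : ℍ) :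
    geodesicHull ({g • x} ∪ g • K) = g • geodesicHull ({x} ∪ K) := by
  ext w
  rw [mem_geodesicHull_singleton_union (hK.smul g) (hne.smul_set), Set.mem_smul_set_iff_inv_smul_mem,
    mem_geodesicHull_singleton_union hK hne]
  constructor
  · rintro ⟨_, ⟨c, hc, rfl⟩, h⟩
    exact ⟨c, hc, by simpa using h.smul g⁻¹⟩
  · rintro ⟨c, hc, h⟩
    exact ⟨g • c, ⟨c, hc, rfl⟩, by simpa using h.smul g⟩

lemma volume_smul (g : SL(2, ℝ)) (S : Set ℍ) : volume (g • S) = volume S :=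
  measure_smul (μ := (volume : Measure ℍ)) (g : GL (Fin 2) ℝ) S

lemma exists_smul_re_eq_zero_of_re_ne_zero (p q z : ℍ)
    (h : ∀ g : SL(2, ℝ), (g • p).re = 0 → (g • q).re = 0 → (g • z).re ≠ 0) :
    ∃ g : SL(2, ℝ), (g • p).re = 0 ∧ (g • q).re = 0 ∧ 0 < (g • z).re := by
  obtain ⟨g, hp, hq⟩ := exists_smul_re_eq_zero p q
  rcases (h g hp hq).lt_or_gt with hz | hz
  -- `z ↦ -1/z` preserves the imaginary axis and exchanges its two sides.
  · set S : SL(2, ℝ) := ⟨!![0, -1; 1, 0], by simp⟩ with hS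
    have aux : ∀ w : ℍ, ∃ D : ℝ, 0 < D ∧ (S • w).re * D = -w.re := by
      intro w
      obtain ⟨D, hD, -, h, -⟩ := smul_eqs S w
      exact ⟨D, hD, by simpa [hS] using h⟩
    refine ⟨S * g, ?_, ?_, ?_⟩ <;> rw [mul_smul]
    · obtain ⟨D, hD, h⟩ := aux (g • p)
      rw [hp, neg_zero] at h
      exact (mul_eq_zero.1 h).resolve_right hD.ne'
    · obtain ⟨D, hD, h⟩ := aux (g • q)
      rw [hq, neg_zero] at h
      exact (mul_eq_zero.1 h).resolve_right hD.ne'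
    · obtain ⟨D, hD, h⟩ := aux (g • z)
      exact pos_of_mul_pos_left (h ▸ neg_pos.2 hz) hD.le
  · exact ⟨g, hp, hq, hz⟩

/-- The area of `[x, K]` is quasiconvex in `x`. -/
lemma exists_volume_geodesicHull_le_of_notMem {K : Set ℍ} (hK : IsConvexBody K) {x z y : ℍ}
    (hxy : Between x z y) (hz : z ∉ K) : ∃ w, (w = x ∨ w = y) ∧
      volume (geodesicHull ({z} ∪ K)) ≤ volume (geodesicHull ({w} ∪ K)) := by
  have hconv := hK.isGeodesicallyConvex
  have hne : K.Nonempty := hK.nonempty_interior.mono interior_subset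
  obtain ⟨_, ⟨p, hp, rfl⟩, _, ⟨q, hq, rfl⟩, hcone'⟩ :=
    exists_supporting_cone (hK.isCompact.image continuous_chart)
      (isGeodesicallyConvex_iff_convex_image.1 hconv) (hne.image _)
      (fun h => hz (chart_injective.mem_set_image.1 h))
  have hcone : ∀ c ∈ K, ∃ e, Between p e q ∧ (Between z c e ∨ Between z e c) := by
    intro c hc
    obtain ⟨e, he, h⟩ := hcone' _ ⟨c, hc, rfl⟩
    obtain ⟨e, rfl⟩ := convex_range_chart.segment_subset ⟨p, rfl⟩ ⟨q, rfl⟩ he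
    exact ⟨e, he, h⟩
  -- If `z` were on the geodesic through `p` and `q`, the cone would degenerate and `K` would lie on
  -- that geodesic, contradicting its nonempty interior.
  have hnc : ∀ g : SL(2, ℝ), (g • p).re = 0 → (g • q).re = 0 → (g • z).re ≠ 0 := by
    intro g hgp hgq hgz
    have hline : ∀ c ∈ K, (g • c).re = 0 := by
      intro c hc
      obtain ⟨e, he, h⟩ := hcone c hc
      have hge := (he.smul g).re_eq_zero hgp hgq
      rcases h with h | h
      · exact (h.smul g).re_eq_zero hgz hge
      · obtain ⟨t, ht, h1, h2⟩ := between_iff.1 (h.smul g)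
        rw [hge, hgz, mul_zero, zero_add] at h1
        refine (mul_eq_zero.1 h1.symm).resolve_left fun ht0 => hz ?_
        have : g • e = g • z := by
          refine chart_injective (Prod.ext (hge.trans hgz.symm) ?_)
          simpa [chart, ht0] using h2
        rw [← smul_left_cancel g this]
        exact hconv.mem_of_between hp hq he
    have hopen : IsOpen (UpperHalfPlane.re '' (g • interior K)) :=
      isOpenMap_re _ (isOpen_interior.smul g)
    have heq : UpperHalfPlane.re '' (g • interior K) = {0} := by
      refine Set.Nonempty.subset_singleton_iff
        ((hK.nonempty_interior.smul_set).image _) |>.1 ?_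
      rintro _ ⟨_, ⟨c, hc, rfl⟩, rfl⟩
      exact hline c (interior_subset hc)
    rw [heq] at hopen
    exact not_isOpen_singleton 0 hopen
  obtain ⟨g, hgp, hgq, hgz⟩ := exists_smul_re_eq_zero_of_re_ne_zero p q z hnc
  have hcone_g : ∀ c ∈ g • K, ∃ e, Between (g • p) e (g • q) ∧
      (Between (g • z) c e ∨ Between (g • z) e c) := by
    rintro _ ⟨c, hc, rfl⟩
    obtain ⟨e, he, h⟩ := hcone c hc
    exact ⟨g • e, he.smul g, h.imp (fun h => h.smul g) (fun h => h.smul g)⟩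
  have hgpK : g • p ∈ g • K := ⟨p, hp, rfl⟩
  have hgqK : g • q ∈ g • K := ⟨q, hq, rfl⟩
  obtain ⟨w, hw, hle⟩ : ∃ w, (w = g • x ∨ w = g • y) ∧
      volume (geodesicHull ({g • z} ∪ g • K)) ≤ volume (geodesicHull ({w} ∪ g • K)) := by
    rcases le_total (g • p).im (g • q).im with h | h
    · exact exists_volume_geodesicHull_le (hK.isCompact.smul g) (hconv.smul g) hgpK hgqK hgp hgq h
        hgz hcone_g (hxy.smul g)
    · refine exists_volume_geodesicHull_le (hK.isCompact.smul g) (hconv.smul g) hgqK hgpK hgq hgp h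
        hgz (fun c hc => ?_) (hxy.smul g)
      obtain ⟨e, he, h⟩ := hcone_g c hc
      exact ⟨e, he.symm, h⟩
  rw [geodesicHull_smul hconv hne, volume_smul] at hle
  rcases hw with rfl | rfl <;> rw [geodesicHull_smul hconv hne, volume_smul] at hle
  · exact ⟨x, .inl rfl, hle⟩
  · exact ⟨y, .inr rfl, hle⟩

end HyperbolicPlane

theorem mainTheorem6 (K : Set UpperHalfPlane) (hK : HyperbolicPlane.IsConvexBody K)
    (δ : ℝ) (hδ : 0 < δ) :
    HyperbolicPlane.IsGeodesicallyConvex (HyperbolicPlane.illuminationBody δ K) := by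
  rw [HyperbolicPlane.isGeodesicallyConvex_iff_between]
  intro x hx y hy z hxy
  by_cases hz : z ∈ K
  · have h : HyperbolicPlane.geodesicHull ({z} ∪ K) ⊆ K :=
      Set.sInter_subset_of_mem ⟨hK.isGeodesicallyConvex,
        Set.union_subset (Set.singleton_subset_iff.2 hz) subset_rfl⟩
    change MeasureTheory.volume (HyperbolicPlane.geodesicHull ({z} ∪ K) \ K) ≤ _
    rw [Set.sdiff_eq_empty.2 h, MeasureTheory.measure_empty]
    exact zero_le
  -- `K` has finite area, so comparing `[w, K] \ K` reduces to comparing `[w, K]`.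
  · have hdiff : ∀ w, MeasureTheory.volume (HyperbolicPlane.geodesicHull ({w} ∪ K) \ K) =
        MeasureTheory.volume (HyperbolicPlane.geodesicHull ({w} ∪ K)) -
          MeasureTheory.volume K := fun w =>
      MeasureTheory.measure_sdiff
        (Set.subset_union_right.trans (HyperbolicPlane.subset_geodesicHull _))
        hK.isCompact.measurableSet.nullMeasurableSet hK.isCompact.measure_lt_top.ne
    obtain ⟨w, hw, hle⟩ := HyperbolicPlane.exists_volume_geodesicHull_le_of_notMem hK hxy hz
    have hwI : w ∈ HyperbolicPlane.illuminationBody δ K := by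
      rcases hw with rfl | rfl
      exacts [hx, hy]
    change MeasureTheory.volume (HyperbolicPlane.geodesicHull ({z} ∪ K) \ K) ≤ _
    refine le_trans ?_ hwI
    rw [hdiff, hdiff]
    exact tsub_le_tsub_right hle _
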